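/- Let $[n]=\{1,\dots,n\}$ be a set of types of goods, let $K_n$ be the complete graph on $[n]$, and let $d=n+\binom n2$, the coordinates of a vector of length $d$ being indexed by the vertices $i$ and the edges $ij$ of $K_n$. For $S\subseteq[n]$ let $a_S\in\{0,1\}^d$ be the vector with $a_{S,i}=1$ iff $i\in S$ and $a_{S,ij}=1$ iff $i,j\in S$. There are $m$ agents, and agent $b$ has a graphical valuation $$v^b(S)=\langle w^b,a_S\rangle=\sum_{i\in S}w^b_i+\sum_{\{i,j\}\subseteq S,\ i\ne j}w^b_{ij}\in\mathbb R\cup\{-\infty\},\qquad S\subseteq[n],$$ with $w^b\in(\mathbb R\cup\{-\infty\})^d$. Agent $b$ \emph{bids on the clique} $K_{S^b}$, $S^b\subseteq[n]$, if $w^b$ is finite on all vertices and edges of $K_{S^b}$ and $w^b_i=-\infty$ for every vertex $i\notin S^b$. The valuations $v^1,\dots,v^m$ are \emph{covering} if every agent $b$ bids on a clique $K_{S^b}$ and $\bigcup_{b}S^b=[n]$. Under anonymous graphical pricing with price vector $p\in\mathbb R^d$ (the same for all agents) the bundle $S$ costs $\langle p,a_S\rangle$, and the demand set of agent $b$ is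 $$D(v^b,p)=\operatorname{argmax}_{S\subseteq[n]}\bigl(v^b(S)-\langle p,a_S\rangle\bigr),$$ where a set $S$ is identified with $a_S$. The auction has a \emph{competitive equilibrium at the bundle} $a^*\in\mathbb N^n$ if there are a price vector $p\in\mathbb R^d$ and an allocation $(a^1,\dots,a^m)$ with $a^b\in D(v^b,p)$ for all $b\in[m]$ such that the first $n$ coordinates of $\sum_b a^b$ are $a^*$. \textbf{Theorem.} For all $n$ and $m$, all covering graphical valuations $v^1,\dots,v^m$ and every bundle $a^*\in\{0,1\}^n$, the auction has a competitive equilibrium with anonymous graphical pricing at $a^*$. -/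

import Mathlib

namespace GraphicalAuction

/-- The index set `[n] ⊔ E(G)`: a coordinate for every type of good (vertex of `G`) and one for
every edge of `G`. -/
abbrev Coord {n : ℕ} (G : SimpleGraph (Fin n)) : Type := Fin n ⊕ G.edgeSet

/-- A (possibly extended) valuation: every bundle `S ⊆ [n]` gets a value in `ℝ ∪ {-∞}`. -/
abbrev Valuation (n : ℕ) : Type := Finset (Fin n) → WithBot ℝ

open Classical in
/-- The characteristic vector `a_S ∈ {0,1}^([n] ⊔ E(G))` of a set of types `S ⊆ [n]`: the
coordinate of a vertex `i` is `1` iff `i ∈ S`, the coordinate of an edge `ij` is `1` iff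
`i, j ∈ S`. -/
noncomputable def charVec {n : ℕ} (G : SimpleGraph (Fin n)) (S : Finset (Fin n)) : Coord G → ℤ
  | Sum.inl i => if i ∈ S then 1 else 0
  | Sum.inr e => if ∀ i ∈ (e : Sym2 (Fin n)), i ∈ S then 1 else 0

open Classical in
/-- The graphical function on bundles with weight vector `w`:
`S ↦ ∑_{i ∈ S} w_i + ∑_{ij ∈ E(G), i, j ∈ S} w_ij`.
It is used for real prices and for weights in `ℝ ∪ {-∞}`; writing it as a sum over the vertices
and edges inside `S` is the pairing `⟨w, a_S⟩` with `0 · (-∞) = 0`. -/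
noncomputable def graphical {n : ℕ} {G : SimpleGraph (Fin n)} {M : Type} [AddCommMonoid M]
    (w : Coord G → M) (S : Finset (Fin n)) : M :=
  ∑ i ∈ S, w (Sum.inl i) +
    ∑ e ∈ Finset.univ.filter (fun e : G.edgeSet => ∀ i ∈ (e : Sym2 (Fin n)), i ∈ S),
      w (Sum.inr e)

/-- The utility `v(S) - ⟨p, a_S⟩` of the bundle `S` at the graphical price vector `p`. -/
noncomputable def utility {n : ℕ} {G : SimpleGraph (Fin n)} (v : Valuation n)
    (p : Coord G → ℝ) (S : Finset (Fin n)) : WithBot ℝ :=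
  v S + ((-graphical p S : ℝ) : WithBot ℝ)

/-- The demand set `D(v, p) = argmax_{S ⊆ [n]} (v(S) - ⟨p, a_S⟩)`, with a bundle `S` written as
its characteristic vector `a_S`. -/
def demand {n : ℕ} {G : SimpleGraph (Fin n)} (v : Valuation n) (p : Coord G → ℝ) :
    Set (Coord G → ℤ) :=
  {a | ∃ S : Finset (Fin n), a = charVec G S ∧
    ∀ T : Finset (Fin n), utility v p T ≤ utility v p S}

/-- The coordinate projection that forgets the edge coordinates. -/
def proj {n : ℕ} {G : SimpleGraph (Fin n)} (a : Coord G → ℤ) : Fin n → ℤ :=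
  fun i => a (Sum.inl i)

/-- The auction with valuations `v` has a competitive equilibrium at the allocation-price pair
`(alloc, p)`. The price `p` is anonymous: the same for all agents. -/
def IsCompetitiveEquilibrium {n m : ℕ} {G : SimpleGraph (Fin n)} (v : Fin m → Valuation n)
    (alloc : Fin m → Coord G → ℤ) (p : Coord G → ℝ) : Prop :=
  ∀ b, alloc b ∈ demand (v b) p

/-- The auction has a competitive equilibrium at the point `a` and the price `p`: some allocation
with total `a` gives every agent an element of its demand set. -/
def HasCEAt {n m : ℕ} {G : SimpleGraph (Fin n)} (v : Fin m → Valuation n)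
    (a : Coord G → ℤ) (p : Coord G → ℝ) : Prop :=
  ∃ alloc : Fin m → Coord G → ℤ, a = ∑ b, alloc b ∧ IsCompetitiveEquilibrium v alloc p

/-- The auction has, under anonymous graphical pricing with value graph `G`, a competitive
equilibrium at the bundle `aStar ∈ ℕ^n`: there are a point `a` over `aStar` and a price `p`
at which it has one. All items of the bundle are sold. -/
def HasCEAtBundle {n m : ℕ} (G : SimpleGraph (Fin n)) (v : Fin m → Valuation n)
    (aStar : Fin n → ℕ) : Prop :=
  ∃ a : Coord G → ℤ, (proj a = fun i => (aStar i : ℤ)) ∧ ∃ p : Coord G → ℝ, HasCEAt v a p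

/-- An agent with valuation `v` bids on the clique `K_S` of `K_n`: `v` is graphical over `K_n`, with
a weight vector in `(ℝ ∪ {-∞})^d` that is finite on the vertices and edges of `K_S` and is `-∞` on
all vertices outside `S`. (The weights of edges that leave `S` are irrelevant, since a
bundle that contains such an edge has value `-∞` already.) -/
def BidsOnClique {n : ℕ} (v : Valuation n) (S : Finset (Fin n)) : Prop :=
  ∃ w : Coord (⊤ : SimpleGraph (Fin n)) → WithBot ℝ,
    v = graphical w ∧
    (∀ i ∈ S, w (Sum.inl i) ≠ ⊥) ∧
    (∀ e : (⊤ : SimpleGraph (Fin n)).edgeSet, (∀ i ∈ (e : Sym2 (Fin n)), i ∈ S) →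
      w (Sum.inr e) ≠ ⊥) ∧
    (∀ i ∉ S, w (Sum.inl i) = ⊥)

/-- The valuations `v` of the agents are covering: every agent `b` bids on a clique
`K_{S^b}`, and the sets `S^b` cover `[n]`. -/
def IsCovering {n m : ℕ} (v : Fin m → Valuation n) : Prop :=
  ∃ S : Fin m → Finset (Fin n), (∀ b, BidsOnClique (v b) (S b)) ∧ ∀ i, ∃ b, i ∈ S b

end GraphicalAuction

namespace GraphicalAuction

open Finset

/-! Covering lets every sold good be given to an agent whose clique contains it. This partitions the
sold goods into parts, one per agent (possibly empty), each of finite value to its agent. With the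
parts as items, unit-demand agents have an assignment equilibrium: prices `c` and a permutation `σ`
(`exists_assignment_prices_withBot`), found by minimising the dual and applying Hall's theorem.
Graphical prices can enforce this market. The defect `fibreDefect` is quadratic in the indicator of
a bundle, vanishes exactly on the empty bundle and the parts, and is a positive integer elsewhere.
Spreading `c` linearly over each part and adding a large multiple of the defect makes every other
bundle no better than the empty one. -/

/-! ### Assignment market: LP duality and Hall's theorem -/

/-- The dual objective of the assignment problem with value matrix `M`, at the prices `c`. -/
noncomputable def assignmentDual {ι : Type*} [Fintype ι] [Nonempty ι] (M : ι → ι → ℝ)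
    (c : ι → ℝ) : ℝ :=
  ∑ j, c j + ∑ i, univ.sup' univ_nonempty fun j => M i j - c j

theorem continuous_assignmentDual {ι : Type*} [Fintype ι] [Nonempty ι] (M : ι → ι → ℝ) :
    Continuous (assignmentDual M) := by
  unfold assignmentDual
  refine (by fun_prop : Continuous fun c : ι → ℝ => ∑ j, c j).add
    (continuous_finsetSum _ fun i _ => ?_)
  exact Continuous.finset_sup'_apply _ fun j _ => by fun_prop

/-- There are as many agents as items, so the two changes cancel. This allows prices to be
normalised to have minimum 0. -/
theorem assignmentDual_sub_const {ι : Type*} [Fintype ι] [Nonempty ι] (M : ι → ι → ℝ)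
    (c : ι → ℝ) (t : ℝ) : assignmentDual M (fun j => c j - t) = assignmentDual M c := by
  have h : ∀ i, univ.sup' univ_nonempty (fun j => M i j - (c j - t)) =
      univ.sup' univ_nonempty (fun j => M i j - c j) + t := by
    intro i
    apply le_antisymm
    · refine sup'_le _ _ fun j _ => ?_
      have := le_sup' (fun j => M i j - c j) (mem_univ j)
      linarith
    · rw [← le_sub_iff_add_le]
      refine sup'_le _ _ fun j _ => ?_
      have := le_sup' (fun j => M i j - (c j - t)) (mem_univ j)
      linarith
  simp only [assignmentDual, h, sum_sub_distrib, sum_add_distrib, sum_const]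
  ring

theorem exists_isMin_assignmentDual {ι : Type*} [Fintype ι] [Nonempty ι] (M : ι → ι → ℝ) :
    ∃ c, ∀ c', assignmentDual M c ≤ assignmentDual M c' := by
  -- With minimum price 0 attained at `k`, the utilities sum to at least `∑ i, M i k`. A price above
  -- `R` thus makes the dual exceed its value at 0.
  set R : ℝ := |assignmentDual M 0| + ∑ j, |∑ i, M i j| with hR
  have hR0 : 0 ≤ R := by positivity
  obtain ⟨c, -, hc⟩ := (isCompact_univ_pi fun _ : ι => isCompact_Icc (a := (0 : ℝ)) (b := R)
    ).exists_isMinOn ⟨0, Set.mem_univ_pi.2 fun _ => ⟨le_rfl, hR0⟩⟩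
    (continuous_assignmentDual M).continuousOn
  refine ⟨c, fun c' => ?_⟩
  obtain ⟨k, hk⟩ := Finite.exists_min c'
  rw [← assignmentDual_sub_const M c' (c' k)]
  by_cases hbox : ∀ j, c' j - c' k ≤ R
  · exact hc (Set.mem_univ_pi.2 fun j => ⟨sub_nonneg.2 (hk j), hbox j⟩)
  push Not at hbox
  obtain ⟨j, hj⟩ := hbox
  have h0 : assignmentDual M c ≤ assignmentDual M 0 :=
    hc (Set.mem_univ_pi.2 fun j => ⟨le_rfl, hR0⟩)
  have h1 : c' j - c' k ≤ ∑ j, (c' j - c' k) :=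
    single_le_sum (f := fun j => c' j - c' k) (fun j _ => sub_nonneg.2 (hk j)) (mem_univ j)
  have h2 : ∑ i, M i k ≤ ∑ i, univ.sup' univ_nonempty fun j => M i j - (c' j - c' k) :=
    sum_le_sum fun i _ => by
      have := le_sup' (fun j => M i j - (c' j - c' k)) (mem_univ k)
      rwa [sub_self, sub_zero] at this
  have h3 : |∑ i, M i k| ≤ ∑ j, |∑ i, M i j| :=
    single_le_sum (f := fun j => |∑ i, M i j|) (fun j _ => abs_nonneg _) (mem_univ k)
  have h4 := neg_abs_le (∑ i, M i k)
  have h5 := le_abs_self (assignmentDual M 0)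
  simp only [assignmentDual] at h0 h1 h2 h5 hR ⊢
  linarith

/-- Unit-demand agents with a square value matrix have a Walrasian equilibrium in which every
item is sold. -/
theorem exists_assignment_prices {ι : Type*} [Fintype ι] (M : ι → ι → ℝ) :
    ∃ (c : ι → ℝ) (σ : Equiv.Perm ι), ∀ i j, M i j - c j ≤ M i (σ i) - c (σ i) := by
  classical
  cases isEmpty_or_nonempty ι
  · exact ⟨0, 1, fun i => isEmptyElim i⟩
  obtain ⟨c, hc⟩ := exists_isMin_assignmentDual M
  set u : ι → ℝ := fun i => univ.sup' univ_nonempty fun j => M i j - c j with hu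
  have hle : ∀ i j, M i j - c j ≤ u i := fun i j =>
    le_sup' (fun j => M i j - c j) (mem_univ j)
  let t : ι → Finset ι := fun i => univ.filter fun j => M i j - c j = u i
  -- If Hall's condition fails at `s`, raising the prices of the items demanded by `s` by a small
  -- `ε` costs less than the `#s * ε` lost in utility, so the dual drops below its minimum.
  have hall : ∀ s : Finset ι, #s ≤ #(s.biUnion t) := by
    by_contra! ⟨s, hs⟩
    obtain ⟨ε, hε, hpos⟩ : ∃ ε : ℝ, (∀ i j, j ∉ t i → M i j - c j + ε < u i) ∧ 0 < ε := by
      have h : ∀ᶠ ε : ℝ in nhdsWithin 0 (Set.Ioi 0), ∀ i j, j ∉ t i → M i j - c j + ε < u i := by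
        refine nhdsWithin_le_nhds (Filter.eventually_all.2 fun i => Filter.eventually_all.2
          fun j => Filter.eventually_imp_distrib_left.2 fun hj => ?_)
        have hlt : M i j - c j + 0 < u i := by
          rw [add_zero]
          exact lt_of_le_of_ne (hle i j) (by simpa [t] using hj)
        exact (by fun_prop : Continuous fun ε : ℝ => M i j - c j + ε).continuousAt.eventually_lt
          continuousAt_const hlt
      exact (h.and self_mem_nhdsWithin).exists
    have h1 := hc fun j => c j + if j ∈ s.biUnion t then ε else 0
    have h2 : ∀ i, (univ.sup' univ_nonempty fun j =>
        M i j - (c j + if j ∈ s.biUnion t then ε else 0)) ≤ u i - if i ∈ s then ε else 0 := by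
      intro i
      refine sup'_le _ _ fun j _ => ?_
      have := hle i j
      by_cases hi : i ∈ s
      · by_cases hj : j ∈ s.biUnion t
        · simp only [hi, hj, if_true]; linarith
        · have := hε i j fun h => hj (mem_biUnion.2 ⟨i, hi, h⟩)
          simp only [hi, hj, if_true, if_false]; linarith
      · simp only [hi, if_false]
        split_ifs <;> linarith
    have h3 := sum_le_sum fun i (_ : i ∈ univ) => h2 i
    have h4 : (#(s.biUnion t) : ℝ) * ε < #s * ε := by gcongr
    rw [sum_sub_distrib] at h3
    simp only [assignmentDual, sum_add_distrib, sum_ite_mem, univ_inter, sum_const,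
      nsmul_eq_mul] at h1 h3
    linarith
  obtain ⟨g, hg, hgt⟩ := (all_card_le_biUnion_card_iff_exists_injective t).1 hall
  refine ⟨c, Equiv.ofBijective g (Finite.injective_iff_bijective.1 hg), fun i j => ?_⟩
  have := (mem_filter.1 (hgt i)).2
  simpa [this] using hle i j

/-- The assignment theorem for values in `ℝ ∪ {-∞}`, when some perfect matching has finite value. -/
theorem exists_assignment_prices_withBot {ι : Type*} [Fintype ι] (M : ι → ι → WithBot ℝ)
    (hM : ∀ i, M i i ≠ ⊥) :
    ∃ (c : ι → ℝ) (σ : Equiv.Perm ι), (∀ i, M i (σ i) ≠ ⊥) ∧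
      ∀ i j, M i j + ((-c j : ℝ) : WithBot ℝ) ≤ M i (σ i) + ((-c (σ i) : ℝ) : WithBot ℝ) := by
  classical
  set B : ℝ := ∑ i, ∑ j, |(M i j).unbotD 0| with hB
  have hBle : ∀ i j, |(M i j).unbotD 0| ≤ B := fun i j =>
    (single_le_sum (f := fun j => |(M i j).unbotD 0|) (fun _ _ => abs_nonneg _)
      (mem_univ j)).trans
    (single_le_sum (f := fun i => ∑ j, |(M i j).unbotD 0|)
      (fun _ _ => sum_nonneg fun _ _ => abs_nonneg _) (mem_univ i))
  have hB0 : 0 ≤ B := sum_nonneg fun _ _ => sum_nonneg fun _ _ => abs_nonneg _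
  -- Replacing `⊥` by `-K`, any matching that uses such an entry totals less than `-card ι * B`,
  -- hence less than the diagonal.
  set K : ℝ := 2 * Fintype.card ι * B + 1 with hK
  obtain ⟨c, σ, h⟩ := exists_assignment_prices fun i j => (M i j).unbotD (-K)
  have hval : ∀ i j, M i j ≠ ⊥ → |(M i j).unbotD (-K)| ≤ B := by
    intro i j hij
    have := hBle i j
    lift M i j to ℝ using hij with x
    simpa using this
  have hσ : ∀ i, M i (σ i) ≠ ⊥ := by
    intro i hi
    have hsum := sum_le_sum fun i (_ : i ∈ univ) => h i i
    rw [sum_sub_distrib, sum_sub_distrib, Equiv.sum_comp σ c] at hsum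
    have hlow : ∑ i : ι, -B ≤ ∑ i, (M i i).unbotD (-K) :=
      sum_le_sum fun i _ => (abs_le.1 (hval i i (hM i))).1
    have hup : ∀ k, (M k (σ k)).unbotD (-K) ≤ B := by
      intro k
      by_cases hk : M k (σ k) = ⊥
      · rw [hk, WithBot.unbotD_bot]
        have : 0 ≤ 2 * Fintype.card ι * B := by positivity
        linarith
      · exact (abs_le.1 (hval k _ hk)).2
    have hsplit := add_sum_erase univ (fun k => (M k (σ k)).unbotD (-K)) (mem_univ i)
    simp only [hi, WithBot.unbotD_bot] at hsplit
    have hrest : ∑ k ∈ univ.erase i, (M k (σ k)).unbotD (-K) ≤ ∑ k ∈ univ.erase i, B :=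
      sum_le_sum fun k _ => hup k
    have hrest' : ∑ k ∈ univ.erase i, B ≤ ∑ k : ι, B :=
      sum_le_sum_of_subset_of_nonneg (erase_subset _ _) fun _ _ _ => hB0
    simp only [sum_const, card_univ, nsmul_eq_mul] at hlow hrest'
    simp only [sum_const, nsmul_eq_mul] at hrest
    linarith
  refine ⟨c, σ, hσ, fun i j => ?_⟩
  have hij := h i j
  have hi := hσ i
  by_cases hb : M i j = ⊥
  · simp [hb]
  lift M i j to ℝ using hb with x
  lift M i (σ i) to ℝ using hi with y
  simp only [WithBot.unbotD_coe] at hij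
  exact_mod_cast (by linarith : x + -c j ≤ y + -c (σ i))

/-! ### Quadratic prices and the fibre defect -/

/-- The price vector with linear part `ℓ` and symmetric quadratic part `H`. -/
def quadraticPrice {n : ℕ} (ℓ : Fin n → ℝ) (H : Fin n → Fin n → ℝ)
    (hH : ∀ i j, H i j = H j i) : Coord (⊤ : SimpleGraph (Fin n)) → ℝ
  | Sum.inl i => ℓ i + H i i
  | Sum.inr e => 2 * Sym2.lift ⟨H, hH⟩ (e : Sym2 (Fin n))

theorem graphical_quadraticPrice {n : ℕ} (ℓ : Fin n → ℝ) (H : Fin n → Fin n → ℝ)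
    (hH : ∀ i j, H i j = H j i) (S : Finset (Fin n)) :
    graphical (quadraticPrice ℓ H hH) S = ∑ i ∈ S, ℓ i + ∑ i ∈ S, ∑ j ∈ S, H i j := by
  classical
  have hoff : ∑ p ∈ S.offDiag, H p.1 p.2 = ∑ e ∈ S.sym2.filter (fun e => ¬ e.IsDiag),
      2 * Sym2.lift ⟨H, hH⟩ e := by
    have hswap : ∑ p ∈ S.offDiag with ¬ p.1 < p.2, H p.1 p.2 =
        ∑ p ∈ S.offDiag with p.1 < p.2, H p.1 p.2 := by
      refine sum_nbij' Prod.swap Prod.swap ?_ ?_ (fun _ _ => rfl) (fun _ _ => rfl)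
        fun p _ => hH _ _
      · intro p hp
        simp only [mem_filter, mem_offDiag, Prod.fst_swap, Prod.snd_swap] at hp ⊢
        exact ⟨⟨hp.1.2.1, hp.1.1, hp.1.2.2.symm⟩, lt_of_le_of_ne (not_lt.1 hp.2) hp.1.2.2.symm⟩
      · intro p hp
        simp only [mem_filter, mem_offDiag, Prod.fst_swap, Prod.snd_swap] at hp ⊢
        exact ⟨⟨hp.1.2.1, hp.1.1, hp.1.2.2.symm⟩, hp.2.le.not_gt⟩
    rw [sum_sym2_filter_not_isDiag, ← sum_filter_add_sum_filter_not _ (fun p => p.1 < p.2), hswap,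
      ← mul_sum, two_mul]
    rfl
  have hedge : ∑ e ∈ univ.filter (fun e : (⊤ : SimpleGraph (Fin n)).edgeSet =>
        ∀ i ∈ (e : Sym2 (Fin n)), i ∈ S), 2 * Sym2.lift ⟨H, hH⟩ (e : Sym2 (Fin n)) =
      ∑ e ∈ S.sym2.filter (fun e => ¬ e.IsDiag), 2 * Sym2.lift ⟨H, hH⟩ e := by
    refine sum_bij (fun e _ => (e : Sym2 (Fin n))) ?_ ?_ ?_ ?_
    · intro e he
      exact mem_filter.2 ⟨mem_sym2_iff.2 (mem_filter.1 he).2,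
        SimpleGraph.not_isDiag_of_mem_edgeSet _ e.2⟩
    · exact fun a _ b _ h => Subtype.ext h
    · intro e he
      rw [mem_filter, mem_sym2_iff] at he
      exact ⟨⟨e, by rw [SimpleGraph.edgeSet_top]; exact he.2⟩, by simpa using he.1, rfl⟩
    · intros; rfl
  have hprod : ∑ i ∈ S, ∑ j ∈ S, H i j = ∑ i ∈ S, H i i + ∑ p ∈ S.offDiag, H p.1 p.2 := by
    rw [← sum_product', ← diag_union_offDiag, sum_union (disjoint_diag_offDiag S), sum_diag]
  simp only [graphical, quadraticPrice]
  rw [hprod, hoff, ← hedge, sum_add_distrib, add_assoc]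
  congr!

/-- The number of violations that keep `S` from being empty or a fibre of `f` over some `b`. -/
def fibreDefect {n : ℕ} {β : Type*} [DecidableEq β] (f : Fin n → Option β)
    (S : Finset (Fin n)) : ℕ :=
  ∑ i ∈ S, ((if f i = none then 1 else 0) + #{k ∈ Sᶜ | f i = f k} + #{k ∈ S | f i ≠ f k})

theorem eq_empty_or_fibre_of_fibreDefect_eq_zero {n : ℕ} {β : Type*} [DecidableEq β]
    {f : Fin n → Option β} {S : Finset (Fin n)} (h : fibreDefect f S = 0) :
    S = ∅ ∨ ∃ b, S = ({i | f i = some b} : Finset (Fin n)) := by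
  rcases S.eq_empty_or_nonempty with rfl | ⟨i, hi⟩
  · exact Or.inl rfl
  have hz := (sum_eq_zero_iff.1 h) i hi
  simp only [Nat.add_eq_zero_iff, ite_eq_right_iff, one_ne_zero, imp_false, card_eq_zero,
    filter_eq_empty_iff, mem_compl] at hz
  obtain ⟨⟨h1, h2⟩, h3⟩ := hz
  obtain ⟨b, hb⟩ := Option.ne_none_iff_exists'.1 h1
  refine Or.inr ⟨b, ?_⟩
  ext k
  simp only [mem_filter, mem_univ, true_and]
  constructor
  · intro hk
    have := h3 hk
    rw [← hb]; exact (not_not.1 this).symm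
  · intro hk
    by_contra hkS
    exact h2 hkS (hb.trans hk.symm)

theorem fibreDefect_empty {n : ℕ} {β : Type*} [DecidableEq β] (f : Fin n → Option β) :
    fibreDefect f ∅ = 0 := rfl

theorem fibreDefect_fibre {n : ℕ} {β : Type*} [DecidableEq β] (f : Fin n → Option β) (b : β) :
    fibreDefect f ({i | f i = some b} : Finset (Fin n)) = 0 := by
  refine sum_eq_zero fun i hi => ?_
  have hi' : f i = some b := by simpa using hi
  simp only [hi', Nat.add_eq_zero_iff, card_eq_zero, filter_eq_empty_iff]
  refine ⟨⟨by simp, ?_⟩, ?_⟩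
  · intro k hk
    simp only [mem_compl, mem_filter, mem_univ, true_and] at hk
    exact fun h => hk h.symm
  · intro k hk
    simpa using (by simpa using hk : f k = some b).symm

/-- Adding a multiple of the fibre defect to a linear price gives a graphical price. -/
theorem exists_price_fibreDefect {n : ℕ} {β : Type*} [DecidableEq β] (f : Fin n → Option β)
    (ℓ : Fin n → ℝ) (L : ℝ) :
    ∃ p : Coord (⊤ : SimpleGraph (Fin n)) → ℝ,
      ∀ S, graphical p S = ∑ i ∈ S, ℓ i + L * fibreDefect f S := by
  -- Counting over `Sᶜ` is counting over all goods minus counting over `S`: a linear term and a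
  -- quadratic one.
  refine ⟨quadraticPrice
    (fun i => ℓ i + L * ((if f i = none then 1 else 0) + #{k | f i = f k}))
    (fun i j => if f i = f j then -L else L) (fun i j => by simp only [eq_comm]), fun S => ?_⟩
  rw [graphical_quadraticPrice, sum_add_distrib, add_assoc, ← sum_add_distrib, fibreDefect,
    Nat.cast_sum, mul_sum]
  congr 1
  refine sum_congr rfl fun i _ => ?_
  have hc : #{k | f i = f k} = #{k ∈ S | f i = f k} + #{k ∈ Sᶜ | f i = f k} := by
    rw [← card_union_of_disjoint
      (disjoint_filter_filter (disjoint_compl_right)), ← filter_union, union_compl]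
  rw [sum_ite, sum_const, sum_const, hc]
  push_cast
  simp only [nsmul_eq_mul]
  ring

/-! ### Equilibrium for a partition of the goods -/

theorem graphical_empty {n : ℕ} {G : SimpleGraph (Fin n)} {M : Type} [AddCommMonoid M]
    (w : Coord G → M) : graphical w ∅ = 0 := by
  classical
  have h : (univ.filter fun e : G.edgeSet => ∀ i ∈ (e : Sym2 (Fin n)), i ∈ (∅ : Finset (Fin n)))
      = ∅ := by
    refine filter_eq_empty_iff.2 fun e _ he => ?_
    exact notMem_empty _ (he _ (Sym2.out_fst_mem (e : Sym2 (Fin n))))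
  rw [graphical, sum_empty, zero_add]
  refine Eq.trans ?_ (sum_empty (f := fun e : G.edgeSet => w (Sum.inr e)))
  rw [← h]

theorem BidsOnClique.empty {n : ℕ} {v : Valuation n} {S : Finset (Fin n)}
    (h : BidsOnClique v S) : v ∅ = 0 := by
  obtain ⟨w, rfl, -⟩ := h
  exact graphical_empty w

theorem BidsOnClique.ne_bot {n : ℕ} {v : Valuation n} {S T : Finset (Fin n)}
    (h : BidsOnClique v S) (hT : T ⊆ S) : v T ≠ ⊥ := by
  obtain ⟨w, rfl, hvert, hedge, -⟩ := h
  rw [graphical, Ne, WithBot.add_eq_bot, WithBot.sum_eq_bot_iff, WithBot.sum_eq_bot_iff]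
  rintro (⟨i, hi, hw⟩ | ⟨e, he, hw⟩)
  · exact hvert i (hT hi) hw
  · exact hedge e (fun i hi => hT ((mem_filter.1 he).2 i hi)) hw

/-- An auction in which the goods are partitioned into parts, one acceptable part for every agent,
has graphical prices and a reassignment of the parts that are an equilibrium. -/
theorem exists_price_perm_fibre {n m : ℕ} (v : Fin m → Valuation n) (hv0 : ∀ b, v b ∅ = 0)
    (f : Fin n → Option (Fin m)) (hf : ∀ b, v b {i | f i = some b} ≠ ⊥) :
    ∃ (p : Coord (⊤ : SimpleGraph (Fin n)) → ℝ) (σ : Equiv.Perm (Fin m)),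
      ∀ b T, utility (v b) p T ≤ utility (v b) p {i | f i = some (σ b)} := by
  set A : Fin m → Finset (Fin n) := fun b => {i | f i = some b} with hA
  obtain ⟨c, σ, hσ, hc⟩ := exists_assignment_prices_withBot (fun b j => v b (A j)) hf
  -- The shift `t` makes empty parts free, as graphical prices require, and leaves every agent with
  -- nonnegative utility. Empty parts share one price, since all agents value them at 0; if there
  -- are none, a large `t` works.
  obtain ⟨t, ht0, ht⟩ : ∃ t : ℝ, (∀ j, A j = ∅ → c j = t) ∧
      ∀ b, 0 ≤ v b (A (σ b)) + ((-(c (σ b) - t) : ℝ) : WithBot ℝ) := by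
    by_cases hex : ∃ j, A j = ∅
    · obtain ⟨j, hj⟩ := hex
      have hmono : ∀ j k, A j = ∅ → A k = ∅ → c j ≤ c k := by
        intro j k hj hk
        have h := hc (σ.symm j) k
        simp only [Equiv.apply_symm_apply, hj, hk, hv0, zero_add, WithBot.coe_le_coe] at h
        linarith
      refine ⟨c j, fun k hk => le_antisymm (hmono k j hk hj) (hmono j k hj hk), fun b => ?_⟩
      have h := hc b j
      have hb := hσ b
      simp only [hj, hv0] at h hb
      lift v b (A (σ b)) to ℝ using hb with x
      have : 0 + -c j ≤ x + -c (σ b) := by exact_mod_cast h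
      exact_mod_cast (by linarith : 0 ≤ x + -(c (σ b) - c j))
    · push Not at hex
      refine ⟨∑ b, |(v b (A (σ b))).unbotD 0 - c (σ b)|,
        fun j hj => absurd hj (hex j).ne_empty, fun b => ?_⟩
      have hle := (neg_le_abs _).trans (single_le_sum
        (f := fun b => |(v b (A (σ b))).unbotD 0 - c (σ b)|) (fun _ _ => abs_nonneg _)
        (mem_univ b))
      have hb := hσ b
      generalize (∑ b, |(v b (A (σ b))).unbotD 0 - c (σ b)|) = t at hle ⊢
      lift v b (A (σ b)) to ℝ using hb with x
      simp only [WithBot.unbotD_coe] at hle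
      exact_mod_cast (by linarith : 0 ≤ x + -(c (σ b) - t))
  set ℓ : Fin n → ℝ := fun i => (f i).elim 0 fun b => (c b - t) / #(A b) with hℓ
  have hlin : ∀ j, ∑ i ∈ A j, ℓ i = c j - t := by
    intro j
    have : ∑ i ∈ A j, ℓ i = ∑ i ∈ A j, (c j - t) / #(A j) := by
      refine sum_congr rfl fun i hi => ?_
      have hi' : f i = some j := by simpa [hA] using hi
      simp [hℓ, hi']
    rw [this, sum_const, nsmul_eq_mul]
    rcases (A j).eq_empty_or_nonempty with h | h
    · simp [h, ht0 j h]
    · have : (#(A j) : ℝ) ≠ 0 := by exact_mod_cast h.card_pos.ne'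
      field_simp
  -- Large enough that one unit of defect cancels any finite utility at the linear prices.
  set L : ℝ := ∑ b, ∑ T, |(v b T).unbotD 0 - ∑ i ∈ T, ℓ i| with hL
  have hLle : ∀ b T, |(v b T).unbotD 0 - ∑ i ∈ T, ℓ i| ≤ L := fun b T =>
    (single_le_sum (f := fun T => |(v b T).unbotD 0 - ∑ i ∈ T, ℓ i|) (fun _ _ => abs_nonneg _)
      (mem_univ T)).trans
    (single_le_sum (f := fun b => ∑ T, |(v b T).unbotD 0 - ∑ i ∈ T, ℓ i|)
      (fun _ _ => sum_nonneg fun _ _ => abs_nonneg _) (mem_univ b))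
  have hL0 : 0 ≤ L := sum_nonneg fun _ _ => sum_nonneg fun _ _ => abs_nonneg _
  obtain ⟨p, hp⟩ := exists_price_fibreDefect f ℓ L
  have hpA : ∀ j, graphical p (A j) = c j - t := fun j => by
    rw [hp, hlin, hA, fibreDefect_fibre]; simp
  refine ⟨p, σ, fun b T => ?_⟩
  have hnonneg : 0 ≤ utility (v b) p (A (σ b)) := by
    rw [utility, hpA]; exact ht b
  change utility (v b) p T ≤ utility (v b) p (A (σ b))
  by_cases hd : fibreDefect f T = 0
  · rcases eq_empty_or_fibre_of_fibreDefect_eq_zero hd with rfl | ⟨j, rfl⟩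
    · simpa [utility, hv0, graphical_empty] using hnonneg
    · change utility (v b) p (A j) ≤ _
      have hj := hc b j
      have hb := hσ b
      rw [utility, utility, hpA, hpA]
      by_cases hbot : v b (A j) = ⊥
      · simp [hbot]
      lift v b (A j) to ℝ using hbot with x
      lift v b (A (σ b)) to ℝ using hb with y
      have : x + -c j ≤ y + -c (σ b) := by exact_mod_cast hj
      exact_mod_cast (by linarith : x + -(c j - t) ≤ y + -(c (σ b) - t))
  · refine le_trans ?_ hnonneg
    rw [utility, hp]
    by_cases hbot : v b T = ⊥
    · simp [hbot]
    have hT := le_of_abs_le (hLle b T)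
    lift v b T to ℝ using hbot with x
    have h1 : (1 : ℝ) ≤ fibreDefect f T := by exact_mod_cast Nat.one_le_iff_ne_zero.2 hd
    have h2 : L ≤ L * fibreDefect f T := le_mul_of_one_le_right hL0 h1
    simp only [WithBot.unbotD_coe] at hT
    exact_mod_cast (by linarith : x + -(∑ i ∈ T, ℓ i + L * fibreDefect f T) ≤ 0)

end GraphicalAuction

theorem mainTheorem8 (n m : ℕ) (v : Fin m → GraphicalAuction.Valuation n)
    (hv : GraphicalAuction.IsCovering v)
    (aStar : Fin n → ℕ) (haStar : ∀ i, aStar i = 0 ∨ aStar i = 1) :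
    GraphicalAuction.HasCEAtBundle (⊤ : SimpleGraph (Fin n)) v aStar := by
  classical
  obtain ⟨S, hS, hcov⟩ := hv
  choose owner howner using hcov
  let f : Fin n → Option (Fin m) := fun i => if aStar i = 0 then none else some (owner i)
  have hf : ∀ b, v b (Finset.univ.filter fun i => f i = some b) ≠ ⊥ := by
    refine fun b => (hS b).ne_bot fun i hi => ?_
    have hi' : f i = some b := by simpa using hi
    by_cases h0 : aStar i = 0
    · simp [f, h0] at hi'
    · have : owner i = b := by simpa [f, h0] using hi'
      exact this ▸ howner i
  obtain ⟨p, σ, hp⟩ := GraphicalAuction.exists_price_perm_fibre v (fun b => (hS b).empty) f hf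
  refine ⟨_, ?_, p, fun b => GraphicalAuction.charVec _ (Finset.univ.filter fun i =>
    f i = some (σ b)), rfl, fun b => ⟨_, rfl, hp b⟩⟩
  funext i
  simp only [GraphicalAuction.proj, Finset.sum_apply, GraphicalAuction.charVec, Finset.mem_filter,
    Finset.mem_univ, true_and]
  -- Permuting the parts leaves the total unchanged.
  rw [Equiv.sum_comp σ fun b => if f i = some b then (1 : ℤ) else 0]
  rcases haStar i with h | h <;> simp [f, h]
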